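/- There is an absolute constant $C>0$ such that the following holds. Let $m\ge 2$ be an integer, let $(x_j)_{j\in J}$ and $(y_j)_{j\in J}$ be finite families of vectors in $\mathbb{R}^m$ with its Euclidean norm, and let $(\varepsilon_j)_{j\in J}$ be independent random variables on a probability space with $\mathrm{Prob}\{\varepsilon_j=1\}=\mathrm{Prob}\{\varepsilon_j=-1\}=\frac12$. Then the expectation below is finite, and $$ \mathbb{E}\Big\|\sum_{j} \varepsilon_j\, x_j\otimes y_j\Big\| \le C\sqrt{\log m}\,\bigg(\max_j\|x_j\|\cdot\Big\|\sum_j y_j\otimes y_j\Big\|^{1/2} +\max_j\|y_j\|\cdot\Big\|\sum_j x_j\otimes x_j\Big\|^{1/2}\bigg). $$ Here $x\otimes y$ denotes the operator $z\mapsto\langle x,z\rangle\,y$ on $\mathbb{R}^m$, $\log$ is the natural logarithm, and the norm of an operator is its operator norm on Euclidean $\mathbb{R}^m$. (For the empty family the maxima are read as $0$.) -/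

import Mathlib

open MeasureTheory ProbabilityTheory

/-- The operator `x ⊗ y` on Euclidean space `ℝ^m`, acting by `z ↦ ⟪x, z⟫ y`. -/
noncomputable def tensorOp {m : ℕ} (x y : EuclideanSpace ℝ (Fin m)) :
    EuclideanSpace ℝ (Fin m) →L[ℝ] EuclideanSpace ℝ (Fin m) :=
  InnerProductSpace.rankOne ℝ y x

theorem tensorOp_apply {m : ℕ} (x y z : EuclideanSpace ℝ (Fin m)) :
    tensorOp x y z = inner ℝ x z • y := by
  simp [tensorOp]

/-- `ε` is a family of independent random signs: each `ε j` takes each of the values `1` and `-1`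
with probability `1/2`. -/
structure IsRademacherFamily {ι Ω : Type*} [MeasurableSpace Ω] (μ : Measure Ω)
    (ε : ι → Ω → ℝ) : Prop where
  measurable : ∀ j, Measurable (ε j)
  indep : iIndepFun ε μ
  prob_one : ∀ j, μ {ω | ε j ω = 1} = 1 / 2
  prob_neg_one : ∀ j, μ {ω | ε j ω = -1} = 1 / 2

/-! This is a noncommutative Khintchine inequality proved by the moment method. For symmetric `H j`
with `∑ (H j)² ≤ V` and `X = ∑ ε j H j`, write `E tr X^(2r+2)` as `∑ E[ε j tr(H j X^(2r+1))]` and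
integrate by parts on the cube: flipping the `j`-th sign changes `X` by `2 ε j H j`, so the
difference of powers telescopes. A trace inequality bounds the resulting mixed terms, giving `E tr
X^(2r+2) ≤ (2r+1) V E tr X^(2r)` (`sum_trace_signedSum_pow_succ_le`). Symmetric dilation handles
general operators. Iterating up to `p ≈ log m` turns the dimension factor into a constant and leaves
`√(p V)`. For `A j = x j ⊗ y j`, both square functions are explicit because `(A j)† A j = ‖y j‖² x j
⊗ x j`. -/

section ScalarInequalities

/-! ### Power inequalities and a telescoping identity. -/

theorem pow_mul_pow_add_le_of_nonneg {a b : ℝ} (ha : 0 ≤ a) (hb : 0 ≤ b) (q k : ℕ) :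
    a ^ q * b ^ k + a ^ k * b ^ q ≤ a ^ (q + k) + b ^ (q + k) := by
  have h : 0 ≤ (a ^ q - b ^ q) * (a ^ k - b ^ k) := by
    rcases le_total a b with hab | hab
    · exact mul_nonneg_of_nonpos_of_nonpos (sub_nonpos.2 (pow_le_pow_left₀ ha hab q))
        (sub_nonpos.2 (pow_le_pow_left₀ ha hab k))
    · exact mul_nonneg (sub_nonneg.2 (pow_le_pow_left₀ hb hab q))
        (sub_nonneg.2 (pow_le_pow_left₀ hb hab k))
  rw [pow_add, pow_add]
  linarith

theorem pow_mul_pow_add_le_of_even (a b : ℝ) {q k : ℕ} (h : Even (q + k)) :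
    a ^ q * b ^ k + a ^ k * b ^ q ≤ a ^ (q + k) + b ^ (q + k) := by
  have h1 := pow_mul_pow_add_le_of_nonneg (abs_nonneg a) (abs_nonneg b) q k
  rw [h.pow_abs, h.pow_abs] at h1
  refine le_trans (le_trans (le_abs_self _) (abs_add_le _ _)) ?_
  simpa [abs_mul, abs_pow] using h1

theorem sum_pow_mul_pow_le (a b : ℝ) (r : ℕ) :
    ∑ q ∈ Finset.range (2 * r + 1), a ^ q * b ^ (2 * r - q) ≤
      (2 * r + 1) / 2 * (a ^ (2 * r) + b ^ (2 * r)) := by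
  have h1 := Finset.sum_range_reflect (fun q => a ^ q * b ^ (2 * r - q)) (2 * r + 1)
  have h2 : ∑ q ∈ Finset.range (2 * r + 1),
      (a ^ q * b ^ (2 * r - q) + a ^ (2 * r + 1 - 1 - q) * b ^ (2 * r - (2 * r + 1 - 1 - q))) ≤
      ∑ _q ∈ Finset.range (2 * r + 1), (a ^ (2 * r) + b ^ (2 * r)) := by
    refine Finset.sum_le_sum fun q hq => ?_
    have hq' : q ≤ 2 * r := Nat.lt_succ_iff.1 (Finset.mem_range.1 hq)
    have h3 : q + (2 * r - q) = 2 * r := by omega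
    have h4 : 2 * r - (2 * r + 1 - 1 - q) = q := by omega
    have h5 := pow_mul_pow_add_le_of_even a b (q := q) (k := 2 * r - q) (by rw [h3]; simp)
    rw [h3] at h5
    rw [h4]
    simpa using h5
  rw [Finset.sum_add_distrib, h1] at h2
  simp only [Finset.sum_const, Finset.card_range, nsmul_eq_mul] at h2
  push_cast at h2
  linarith

theorem pow_succ_sub_pow_succ_eq_sum {R : Type*} [Ring R] (a b : R) (n : ℕ) :
    a ^ (n + 1) - b ^ (n + 1) =
      ∑ i ∈ Finset.range (n + 1), a ^ i * (a - b) * b ^ (n - i) := by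
  induction n with
  | zero => simp
  | succ n ih =>
    rw [Finset.sum_range_succ]
    have h : ∑ i ∈ Finset.range (n + 1), a ^ i * (a - b) * b ^ (n + 1 - i) =
        (a ^ (n + 1) - b ^ (n + 1)) * b := by
      rw [ih, Finset.sum_mul]
      refine Finset.sum_congr rfl fun i hi => ?_
      have h1 : n + 1 - i = (n - i) + 1 := by
        have := Finset.mem_range.1 hi
        omega
      rw [h1, pow_succ b (n - i)]
      simp only [mul_assoc]
    rw [h]
    simp only [Nat.sub_self, pow_zero, mul_one]
    rw [pow_succ a (n + 1), pow_succ b (n + 1)]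
    noncomm_ring

end ScalarInequalities

/-! ### Traces of powers of symmetric operators. -/

section TraceInequalities

variable {E : Type*} [NormedAddCommGroup E] [InnerProductSpace ℝ E]

theorem Module.End.pow_apply_of_eq_smul {A : Module.End ℝ E} {v : E} {c : ℝ} (h : A v = c • v)
    (n : ℕ) : (A ^ n) v = c ^ n • v := by
  induction n with
  | zero => simp
  | succ n ih => rw [pow_succ, Module.End.mul_apply, h, map_smul, ih, smul_smul, pow_succ']

theorem inner_pow_apply_self_eq_sum {ι : Type*} [Fintype ι] {A : Module.End ℝ E}
    (hA : A.IsSymmetric) (u : OrthonormalBasis ι ℝ E) {a : ι → ℝ}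
    (hu : ∀ i, A (u i) = a i • u i) (n : ℕ) (v : E) :
    inner ℝ v ((A ^ n) v) = ∑ i, a i ^ n * inner ℝ (u i) v ^ 2 := by
  rw [← u.sum_inner_mul_inner v]
  refine Finset.sum_congr rfl fun i _ => ?_
  have h : inner ℝ (u i) ((A ^ n) v) = a i ^ n * inner ℝ (u i) v := by
    rw [← (hA.pow n) (u i) v, Module.End.pow_apply_of_eq_smul (hu i), real_inner_smul_left]
  rw [h, real_inner_comm]
  ring

/-- Expanding in eigenbases of both operators leaves nonnegative weights independent of `q` and `k`,
so scalar inequalities between eigenvalues lift to traces even if `A` and `B` do not commute. -/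
theorem trace_mul_pow_mul_mul_pow_eq_sum {ι κ : Type*} [Fintype ι] [Fintype κ]
    {H A B : Module.End ℝ E} (hH : H.IsSymmetric) (hA : A.IsSymmetric)
    (u : OrthonormalBasis ι ℝ E) {a : ι → ℝ} (hu : ∀ i, A (u i) = a i • u i)
    (v : OrthonormalBasis κ ℝ E) {b : κ → ℝ} (hv : ∀ i, B (v i) = b i • v i) (q k : ℕ) :
    LinearMap.trace ℝ E (H * A ^ q * H * B ^ k) =
      ∑ l, ∑ i, a i ^ q * b l ^ k * inner ℝ (u i) (H (v l)) ^ 2 := by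
  rw [LinearMap.trace_eq_sum_inner _ v]
  refine Finset.sum_congr rfl fun l _ => ?_
  simp only [Module.End.mul_apply]
  rw [Module.End.pow_apply_of_eq_smul (hv l), map_smul, map_smul, map_smul, real_inner_smul_right,
    ← hH, inner_pow_apply_self_eq_sum hA u hu, Finset.mul_sum]
  exact Finset.sum_congr rfl fun i _ => by ring

variable [FiniteDimensional ℝ E]

theorem sum_trace_mul_pow_mul_mul_pow_le {H A B : Module.End ℝ E} (hH : H.IsSymmetric)
    (hA : A.IsSymmetric) (hB : B.IsSymmetric) (r : ℕ) :
    ∑ q ∈ Finset.range (2 * r + 1), LinearMap.trace ℝ E (H * A ^ q * H * B ^ (2 * r - q)) ≤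
      (2 * r + 1) / 2 * (LinearMap.trace ℝ E (H * A ^ (2 * r) * H) +
        LinearMap.trace ℝ E (H * B ^ (2 * r) * H)) := by
  have hu := hA.apply_eigenvectorBasis rfl
  have hv := hB.apply_eigenvectorBasis rfl
  have h1 := trace_mul_pow_mul_mul_pow_eq_sum (H := H) hH hA _ hu _ hv (2 * r) 0
  have h2 := trace_mul_pow_mul_mul_pow_eq_sum (H := H) hH hA _ hu _ hv 0 (2 * r)
  have h3 : LinearMap.trace ℝ E (H * B ^ (2 * r) * H) =
      LinearMap.trace ℝ E (H * H * B ^ (2 * r)) := by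
    rw [LinearMap.trace_mul_comm, ← mul_assoc]
  simp only [pow_zero, mul_one] at h1 h2
  rw [h3, h1, h2,
    Finset.sum_congr rfl fun q _ => trace_mul_pow_mul_mul_pow_eq_sum hH hA _ hu _ hv q (2 * r - q),
    Finset.sum_comm, ← Finset.sum_add_distrib, Finset.mul_sum]
  refine Finset.sum_le_sum fun l _ => ?_
  rw [Finset.sum_comm, ← Finset.sum_add_distrib, Finset.mul_sum]
  refine Finset.sum_le_sum fun i _ => ?_
  rw [← Finset.sum_mul]
  refine (mul_le_mul_of_nonneg_right (sum_pow_mul_pow_le _ _ r) (sq_nonneg _)).trans_eq ?_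
  simp only [RCLike.ofReal_real_eq_id, id_eq]
  ring

omit [FiniteDimensional ℝ E] in
theorem trace_pow_two_mul_eq_sum {ι : Type*} [Fintype ι] {A : Module.End ℝ E} (hA : A.IsSymmetric)
    (b : OrthonormalBasis ι ℝ E) (r : ℕ) :
    LinearMap.trace ℝ E (A ^ (2 * r)) = ∑ i, ‖(A ^ r) (b i)‖ ^ 2 := by
  rw [LinearMap.trace_eq_sum_inner _ b]
  refine Finset.sum_congr rfl fun i _ => ?_
  rw [two_mul, pow_add, Module.End.mul_apply, ← (hA.pow r), real_inner_self_eq_norm_sq]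

theorem sum_trace_mul_pow_mul_le {ι : Type*} [Fintype ι] {H : ι → Module.End ℝ E}
    (hH : ∀ j, (H j).IsSymmetric) {V : ℝ} (hV : ∀ v, ∑ j, ‖H j v‖ ^ 2 ≤ V * ‖v‖ ^ 2)
    {A : Module.End ℝ E} (hA : A.IsSymmetric) (r : ℕ) :
    ∑ j, LinearMap.trace ℝ E (H j * A ^ (2 * r) * H j) ≤
      V * LinearMap.trace ℝ E (A ^ (2 * r)) := by
  have b := stdOrthonormalBasis ℝ E
  have h (j : ι) : LinearMap.trace ℝ E (H j * A ^ (2 * r) * H j) =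
      ∑ i, ‖H j ((A ^ r) (b i))‖ ^ 2 := by
    rw [two_mul, pow_add, ← mul_assoc, mul_assoc (H j * A ^ r), LinearMap.trace_mul_comm,
      mul_assoc, ← mul_assoc (H j), LinearMap.trace_eq_sum_inner _ b]
    refine Finset.sum_congr rfl fun i _ => ?_
    simp only [Module.End.mul_apply]
    rw [← hA.pow r, ← hH j, real_inner_self_eq_norm_sq]
  rw [Finset.sum_congr rfl fun j _ => h j, Finset.sum_comm, trace_pow_two_mul_eq_sum hA b,
    Finset.mul_sum]
  exact Finset.sum_le_sum fun i _ => hV _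

/-- The trace is a sum of even powers of eigenvalues, so its `2r`-th root dominates each eigenvalue
in absolute value. -/
theorem norm_apply_pow_le_trace {A : Module.End ℝ E} (hA : A.IsSymmetric) {r : ℕ} (hr : r ≠ 0)
    (v : E) : ‖A v‖ ^ (2 * r) ≤ LinearMap.trace ℝ E (A ^ (2 * r)) * ‖v‖ ^ (2 * r) := by
  have h2r : 2 * r ≠ 0 := by omega
  have hu := hA.apply_eigenvectorBasis rfl
  set u := hA.eigenvectorBasis rfl
  set a := hA.eigenvalues rfl
  have htr : LinearMap.trace ℝ E (A ^ (2 * r)) = ∑ i, a i ^ (2 * r) := by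
    rw [LinearMap.trace_eq_sum_inner _ u]
    refine Finset.sum_congr rfl fun i _ => ?_
    rw [Module.End.pow_apply_of_eq_smul (hu i), real_inner_smul_right,
      real_inner_self_eq_norm_sq, u.norm_eq_one]
    simp
  have hnn (i) : 0 ≤ a i ^ (2 * r) := (even_two_mul r).pow_nonneg _
  set T := LinearMap.trace ℝ E (A ^ (2 * r))
  have hT : 0 ≤ T := htr ▸ Finset.sum_nonneg fun i _ => hnn i
  set t := T ^ ((2 * r : ℕ) : ℝ)⁻¹
  have ht : 0 ≤ t := Real.rpow_nonneg hT _
  have htT : t ^ (2 * r) = T := Real.rpow_inv_natCast_pow hT h2r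
  have hat (i) : a i ^ 2 ≤ t ^ 2 := by
    refine sq_le_sq' ?_ ?_ <;> [refine neg_le_of_abs_le ?_; refine le_of_abs_le ?_] <;>
    · refine le_of_pow_le_pow_left₀ h2r ht ?_
      rw [(even_two_mul r).pow_abs, htT, htr]
      exact Finset.single_le_sum (fun i _ => hnn i) (Finset.mem_univ i)
  have hsq : ‖A v‖ ^ 2 ≤ t ^ 2 * ‖v‖ ^ 2 := by
    have h1 : ‖A v‖ ^ 2 = inner ℝ v ((A ^ 2) v) := by
      rw [pow_two A, Module.End.mul_apply, ← hA, real_inner_self_eq_norm_sq]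
    rw [h1, inner_pow_apply_self_eq_sum hA u hu, ← u.sum_sq_norm_inner_right v, Finset.mul_sum]
    refine Finset.sum_le_sum fun i _ => ?_
    rw [Real.norm_eq_abs, sq_abs]
    exact mul_le_mul_of_nonneg_right (hat i) (sq_nonneg _)
  calc ‖A v‖ ^ (2 * r) = (‖A v‖ ^ 2) ^ r := pow_mul _ _ _
    _ ≤ (t ^ 2 * ‖v‖ ^ 2) ^ r := pow_le_pow_left₀ (sq_nonneg _) hsq r
    _ = T * ‖v‖ ^ (2 * r) := by rw [mul_pow, ← pow_mul, ← pow_mul, htT]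

end TraceInequalities

/-! ### Moment recursion on the discrete cube. -/

section RademacherSeries

/-- The real number `1` or `-1` encoded by a Boolean. -/
def boolSign (b : Bool) : ℝ := if b then 1 else -1

theorem boolSign_not (b : Bool) : boolSign (!b) = -boolSign b := by
  cases b <;> simp [boolSign]

theorem boolSign_mul_self (b : Bool) : boolSign b * boolSign b = 1 := by
  cases b <;> simp [boolSign]

variable {ι : Type*} [DecidableEq ι]

/-- Negate one coordinate of a Boolean vector. -/
def flipAt (j : ι) : Equiv.Perm (ι → Bool) :=
  Function.Involutive.toPerm (fun s => Function.update s j (!s j)) fun s => by simp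

theorem flipAt_apply (j : ι) (s : ι → Bool) : flipAt j s = Function.update s j (!s j) := rfl

variable [Fintype ι] {M : Type*} [AddCommGroup M] [Module ℝ M]

/-- The signed sum of a family. -/
def signedSum (H : ι → M) (s : ι → Bool) : M := ∑ j, boolSign (s j) • H j

theorem signedSum_sub_flipAt (H : ι → M) (s : ι → Bool) (j : ι) :
    signedSum H s - signedSum H (flipAt j s) = (2 * boolSign (s j)) • H j := by
  rw [signedSum, signedSum, ← Finset.sum_sub_distrib, Finset.sum_eq_single j]
  · rw [flipAt_apply, Function.update_self, boolSign_not, ← sub_smul]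
    congr 1
    ring
  · intro i _ hij
    rw [flipAt_apply, Function.update_of_ne hij, sub_self]
  · simp

variable {E : Type*} [NormedAddCommGroup E] [InnerProductSpace ℝ E]

omit [DecidableEq ι] in
theorem signedSum_isSymmetric {H : ι → Module.End ℝ E} (hH : ∀ j, (H j).IsSymmetric)
    (s : ι → Bool) : (signedSum H s).IsSymmetric := by
  intro v w
  simp only [signedSum, LinearMap.sum_apply, LinearMap.smul_apply, sum_inner, inner_sum,
    real_inner_smul_left, real_inner_smul_right]
  exact Finset.sum_congr rfl fun j _ => by rw [hH j]

variable [FiniteDimensional ℝ E]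

/-- Discrete integration by parts: flipping coordinate `j` preserves the uniform measure and
reverses the sign, so twice the left side is a sum of differences of odd powers. -/
theorem sum_boolSign_mul_trace_le {H : ι → Module.End ℝ E} (hH : ∀ j, (H j).IsSymmetric)
    (r : ℕ) (j : ι) :
    ∑ s, boolSign (s j) * LinearMap.trace ℝ E (H j * signedSum H s ^ (2 * r + 1)) ≤
      (2 * r + 1) * ∑ s, LinearMap.trace ℝ E (H j * signedSum H s ^ (2 * r) * H j) := by
  set F := fun s : ι → Bool => LinearMap.trace ℝ E (H j * signedSum H s ^ (2 * r + 1))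
  set G := fun s : ι → Bool => LinearMap.trace ℝ E (H j * signedSum H s ^ (2 * r) * H j)
  have h1 : ∑ s, boolSign (s j) * F s = -∑ s, boolSign (s j) * F (flipAt j s) := by
    rw [← Equiv.sum_comp (flipAt j), ← Finset.sum_neg_distrib]
    refine Finset.sum_congr rfl fun s _ => ?_
    rw [flipAt_apply j s, Function.update_self, boolSign_not]
    ring
  have h2 (s : ι → Bool) : boolSign (s j) * F s - boolSign (s j) * F (flipAt j s) ≤
      (2 * r + 1) * (G s + G (flipAt j s)) := by
    have h3 : boolSign (s j) * F s - boolSign (s j) * F (flipAt j s) =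
        2 * ∑ q ∈ Finset.range (2 * r + 1), LinearMap.trace ℝ E
          (H j * signedSum H s ^ q * H j * signedSum H (flipAt j s) ^ (2 * r - q)) := by
      rw [← mul_sub, ← map_sub, ← mul_sub, pow_succ_sub_pow_succ_eq_sum, signedSum_sub_flipAt,
        Finset.mul_sum, map_sum, Finset.mul_sum, Finset.mul_sum]
      refine Finset.sum_congr rfl fun q _ => ?_
      rw [mul_smul_comm, smul_mul_assoc, mul_smul_comm, map_smul, smul_eq_mul, ← mul_assoc]
      rw [mul_left_comm, boolSign_mul_self, mul_one]
      simp only [mul_assoc]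
    have h4 := sum_trace_mul_pow_mul_mul_pow_le (hH j) (signedSum_isSymmetric hH s)
      (signedSum_isSymmetric hH (flipAt j s)) r
    rw [h3]
    linarith
  have h5 := Finset.sum_le_sum fun s (_ : s ∈ Finset.univ) => h2 s
  rw [Finset.sum_sub_distrib, ← Finset.mul_sum, Finset.sum_add_distrib,
    Equiv.sum_comp (flipAt j) G] at h5
  linarith

theorem sum_trace_signedSum_pow_succ_le {H : ι → Module.End ℝ E} (hH : ∀ j, (H j).IsSymmetric)
    {V : ℝ} (hV : ∀ v, ∑ j, ‖H j v‖ ^ 2 ≤ V * ‖v‖ ^ 2) (r : ℕ) :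
    ∑ s, LinearMap.trace ℝ E (signedSum H s ^ (2 * (r + 1))) ≤
      (2 * r + 1) * V * ∑ s, LinearMap.trace ℝ E (signedSum H s ^ (2 * r)) := by
  have h1 (s : ι → Bool) : LinearMap.trace ℝ E (signedSum H s ^ (2 * (r + 1))) =
      ∑ j, boolSign (s j) * LinearMap.trace ℝ E (H j * signedSum H s ^ (2 * r + 1)) := by
    rw [show 2 * (r + 1) = 2 * r + 1 + 1 by ring, pow_succ' _ (2 * r + 1)]
    conv_lhs => rw [signedSum, Finset.sum_mul, map_sum]
    refine Finset.sum_congr rfl fun j _ => ?_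
    rw [smul_mul_assoc, map_smul, smul_eq_mul]
    rfl
  rw [Finset.sum_congr rfl fun s _ => h1 s, Finset.sum_comm]
  refine (Finset.sum_le_sum fun j _ => sum_boolSign_mul_trace_le hH r j).trans ?_
  rw [← Finset.mul_sum, Finset.sum_comm, mul_assoc, Finset.mul_sum (a := V)]
  refine mul_le_mul_of_nonneg_left (Finset.sum_le_sum fun s _ => ?_) (by positivity)
  exact sum_trace_mul_pow_mul_le hH hV (signedSum_isSymmetric hH s) r

/-- The noncommutative Khintchine inequality for the moments of a symmetric Rademacher series. -/
theorem sum_trace_signedSum_pow_le {H : ι → Module.End ℝ E} (hH : ∀ j, (H j).IsSymmetric)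
    {V : ℝ} (hV₀ : 0 ≤ V) (hV : ∀ v, ∑ j, ‖H j v‖ ^ 2 ≤ V * ‖v‖ ^ 2) {r p : ℕ} (hrp : r ≤ p) :
    ∑ s, LinearMap.trace ℝ E (signedSum H s ^ (2 * r)) ≤
      (2 * p * V) ^ r * (2 ^ Fintype.card ι * Module.finrank ℝ E) := by
  induction r with
  | zero => simp [LinearMap.trace_one]
  | succ r ih =>
    have h1 := ih (by omega)
    have h2 : ((r + 1 : ℕ) : ℝ) ≤ p := by exact_mod_cast hrp
    push_cast at h2
    calc _ ≤ (2 * r + 1) * V * ∑ s, LinearMap.trace ℝ E (signedSum H s ^ (2 * r)) :=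
          sum_trace_signedSum_pow_succ_le hH hV r
      _ ≤ (2 * r + 1) * V * ((2 * p * V) ^ r * (2 ^ Fintype.card ι * Module.finrank ℝ E)) :=
          mul_le_mul_of_nonneg_left h1 (by positivity)
      -- Since `r + 1 ≤ p`, each recursion factor `2r + 1` is at most `2p`.
      _ ≤ (2 * p) * V * ((2 * p * V) ^ r * (2 ^ Fintype.card ι * Module.finrank ℝ E)) := by
          gcongr
          linarith
      _ = _ := by ring

end RademacherSeries

/-! ### Passage to general operators by symmetric dilation. -/

section Dilation

variable {E : Type*} [NormedAddCommGroup E] [InnerProductSpace ℝ E] [FiniteDimensional ℝ E]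

/-- The symmetric dilation `(a, b) ↦ (T† b, T a)` of an operator `T`. -/
noncomputable def symmDilation : (E →L[ℝ] E) →ₗ[ℝ] Module.End ℝ (WithLp 2 (E × E)) where
  toFun T :=
    { toFun := fun v =>
        have := FiniteDimensional.complete ℝ E
        WithLp.toLp 2 (ContinuousLinearMap.adjoint T v.snd, T v.fst)
      map_add' := fun v w => by simp [← WithLp.toLp_add]
      map_smul' := fun c v => by simp [← WithLp.toLp_smul] }
  map_add' S T := by
    ext1 v
    simp only [map_add]
    rfl
  map_smul' c T := by
    ext1 v
    simp only [map_smulₛₗ]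
    rfl

theorem symmDilation_apply [CompleteSpace E] (T : E →L[ℝ] E) (v : WithLp 2 (E × E)) :
    symmDilation T v = WithLp.toLp 2 (ContinuousLinearMap.adjoint T v.snd, T v.fst) := rfl

theorem symmDilation_isSymmetric (T : E →L[ℝ] E) : (symmDilation T).IsSymmetric := by
  have := FiniteDimensional.complete ℝ E
  intro v w
  simp only [symmDilation_apply, WithLp.prod_inner_apply]
  rw [ContinuousLinearMap.adjoint_inner_left, ContinuousLinearMap.adjoint_inner_right, add_comm]
  rfl

theorem norm_symmDilation_apply_sq [CompleteSpace E] (T : E →L[ℝ] E) (v : WithLp 2 (E × E)) :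
    ‖symmDilation T v‖ ^ 2 = ‖ContinuousLinearMap.adjoint T v.snd‖ ^ 2 + ‖T v.fst‖ ^ 2 := by
  rw [symmDilation_apply, WithLp.prod_norm_sq_eq_of_L2]
  rfl

theorem norm_pow_le_trace_symmDilation_pow (T : E →L[ℝ] E) {p : ℕ} (hp : p ≠ 0) :
    ‖T‖ ^ (2 * p) ≤ LinearMap.trace ℝ _ (symmDilation T ^ (2 * p)) := by
  have := FiniteDimensional.complete ℝ E
  have h2p : 2 * p ≠ 0 := by omega
  set R := LinearMap.trace ℝ _ (symmDilation T ^ (2 * p))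
  have hR : 0 ≤ R := by
    rw [show R = _ from trace_pow_two_mul_eq_sum (symmDilation_isSymmetric T)
      (stdOrthonormalBasis ℝ _) p]
    exact Finset.sum_nonneg fun i _ => sq_nonneg _
  set t := R ^ ((2 * p : ℕ) : ℝ)⁻¹
  have ht : 0 ≤ t := Real.rpow_nonneg hR _
  have htR : t ^ (2 * p) = R := Real.rpow_inv_natCast_pow hR h2p
  rw [← htR]
  refine pow_le_pow_left₀ (norm_nonneg _) (T.opNorm_le_bound ht fun a => ?_) _
  refine le_of_pow_le_pow_left₀ h2p (by positivity) ?_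
  -- On vectors `(a, 0)` the dilation acts as `T`.
  have h1 := norm_apply_pow_le_trace (symmDilation_isSymmetric T) hp (WithLp.toLp 2 (a, 0))
  have h2 : ‖symmDilation T (WithLp.toLp 2 (a, 0))‖ = ‖T a‖ := by
    rw [← sq_eq_sq₀ (norm_nonneg _) (norm_nonneg _), norm_symmDilation_apply_sq]
    simp
  have h3 : ‖(WithLp.toLp 2 (a, 0) : WithLp 2 (E × E))‖ = ‖a‖ := by
    rw [← sq_eq_sq₀ (norm_nonneg _) (norm_nonneg _), WithLp.prod_norm_sq_eq_of_L2]
    simp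
  rw [h2, h3] at h1
  rwa [mul_pow, htR]

variable {ι : Type*} [Fintype ι] [DecidableEq ι]

theorem sum_norm_signedSum_pow_le [CompleteSpace E] {A : ι → E →L[ℝ] E} {V : ℝ} (hV₀ : 0 ≤ V)
    (hV : ∀ a, ∑ j, ‖A j a‖ ^ 2 ≤ V * ‖a‖ ^ 2)
    (hV' : ∀ a, ∑ j, ‖ContinuousLinearMap.adjoint (A j) a‖ ^ 2 ≤ V * ‖a‖ ^ 2)
    {p : ℕ} (hp : p ≠ 0) :
    ∑ s, ‖signedSum A s‖ ^ (2 * p) ≤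
      (2 * p * V) ^ p * (2 ^ Fintype.card ι * (2 * Module.finrank ℝ E)) := by
  have h1 (s : ι → Bool) :
      symmDilation (signedSum A s) = signedSum (fun j => symmDilation (A j)) s := by
    simp [signedSum]
  have h2 (v : WithLp 2 (E × E)) : ∑ j, ‖symmDilation (A j) v‖ ^ 2 ≤ V * ‖v‖ ^ 2 := by
    simp only [norm_symmDilation_apply_sq, Finset.sum_add_distrib, WithLp.prod_norm_sq_eq_of_L2 v]
    linarith [hV v.fst, hV' v.snd]
  have h3 := sum_trace_signedSum_pow_le (fun j => symmDilation_isSymmetric (A j)) hV₀ h2 le_rfl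
    (r := p)
  have h4 : Module.finrank ℝ (WithLp 2 (E × E)) = 2 * Module.finrank ℝ E := by
    rw [(WithLp.linearEquiv 2 ℝ (E × E)).finrank_eq, Module.finrank_prod, two_mul]
  rw [h4] at h3
  push_cast at h3
  refine le_trans (Finset.sum_le_sum fun s _ => ?_) h3
  rw [← h1]
  exact norm_pow_le_trace_symmDilation_pow _ hp

/-- The noncommutative Khintchine inequality for the expected norm of a Rademacher series. -/
theorem average_norm_signedSum_le [CompleteSpace E] {A : ι → E →L[ℝ] E} {V : ℝ} (hV₀ : 0 ≤ V)
    (hV : ∀ a, ∑ j, ‖A j a‖ ^ 2 ≤ V * ‖a‖ ^ 2)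
    (hV' : ∀ a, ∑ j, ‖ContinuousLinearMap.adjoint (A j) a‖ ^ 2 ≤ V * ‖a‖ ^ 2)
    {p : ℕ} (hp : p ≠ 0) (hdim : 2 * (Module.finrank ℝ E : ℝ) ≤ Real.exp 1 ^ (2 * p)) :
    ∑ s, (2 ^ Fintype.card ι : ℝ)⁻¹ * ‖signedSum A s‖ ≤ Real.exp 1 * √(2 * p * V) := by
  have h2p : 2 * p ≠ 0 := by omega
  refine le_of_pow_le_pow_left₀ h2p (by positivity) ?_
  -- Jensen's inequality passes from the mean to the `2p`-th moment; `hdim` then absorbs the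
  -- dimension into `exp 1 ^ (2 * p)`.
  refine (Real.pow_arith_mean_le_arith_mean_pow Finset.univ
    (fun _ => (2 ^ Fintype.card ι : ℝ)⁻¹) (fun s => ‖signedSum A s‖) (fun _ _ => by positivity)
    (by simp) (fun _ _ => norm_nonneg _) (2 * p)).trans ?_
  rw [← Finset.mul_sum, inv_mul_le_iff₀ (by positivity)]
  refine (sum_norm_signedSum_pow_le hV₀ hV hV' hp).trans ?_
  rw [mul_pow (Real.exp 1), pow_mul (√_), Real.sq_sqrt (by positivity)]
  calc _ = 2 ^ Fintype.card ι * ((2 * Module.finrank ℝ E) * (2 * p * V) ^ p) := by ring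
    _ ≤ _ := by gcongr

end Dilation

/-! ### Reduction of expectations to uniform averages over signs. -/

section Probability

variable {ι Ω : Type*} [Fintype ι] [MeasurableSpace Ω] {μ : Measure Ω} [IsProbabilityMeasure μ]
  {ε : ι → Ω → ℝ}

omit [Fintype ι] in
theorem IsRademacherFamily.ae_eq_one_or (h : IsRademacherFamily μ ε) (j : ι) :
    ∀ᵐ ω ∂μ, ε j ω = 1 ∨ ε j ω = -1 := by
  have hm (c : ℝ) : MeasurableSet {ω | ε j ω = c} := h.measurable j (measurableSet_singleton c)
  have hd : Disjoint {ω | ε j ω = 1} {ω | ε j ω = -1} := by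
    rw [Set.disjoint_left]
    intro ω h1 h2
    simp only [Set.mem_ofPred_eq] at h1 h2
    linarith
  have h1 : μ ({ω | ε j ω = 1} ∪ {ω | ε j ω = -1}) = 1 := by
    rw [measure_union hd (hm _), h.prob_one, h.prob_neg_one, ENNReal.add_halves]
  exact (prob_compl_eq_zero_iff ((hm 1).union (hm (-1)))).2 h1

theorem IsRademacherFamily.measure_preimage (h : IsRademacherFamily μ ε) (s : ι → Bool) :
    μ.real {ω | (fun j => decide (ε j ω = 1)) = s} = (2 ^ Fintype.card ι)⁻¹ := by
  have h1 : {ω | (fun j => decide (ε j ω = 1)) = s} =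
      ⋂ j ∈ Finset.univ, ε j ⁻¹' (if s j then {1} else {1}ᶜ) := by
    ext ω
    simp only [Set.mem_ofPred_eq, funext_iff, Finset.mem_univ, Set.iInter_true, Set.mem_iInter]
    refine forall_congr' fun j => ?_
    cases s j <;> simp
  have h2 (j : ι) : μ (ε j ⁻¹' (if s j then {1} else {1}ᶜ)) = 1 / 2 := by
    have h3 : μ (ε j ⁻¹' {1}) = 1 / 2 := h.prob_one j
    cases s j
    · have h4 := prob_compl_eq_one_sub (μ := μ) (h.measurable j (measurableSet_singleton 1))
      simp only [Bool.false_eq_true, if_false, Set.preimage_compl]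
      rw [h4, h3, one_div, ENNReal.one_sub_inv_two]
    · simpa using h3
  rw [measureReal_def, h1, h.indep.measure_inter_preimage_eq_mul]
  · simp [h2]
  · intro j _
    cases s j <;> simp

theorem IsRademacherFamily.integral_comp [DecidableEq ι] (h : IsRademacherFamily μ ε) (G : (ι → ℝ) → ℝ) :
    Integrable (fun ω => G fun j => ε j ω) μ ∧
      ∫ ω, G (fun j => ε j ω) ∂μ =
        ∑ s : ι → Bool, (2 ^ Fintype.card ι : ℝ)⁻¹ * G fun j => boolSign (s j) := by
  -- Every value other than `1` is encoded as `false`; this misreads `ε j` only on a null set. As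
  -- `S` has finite range, `G` needs no measurability.
  set S : Ω → ι → Bool := fun ω j => decide (ε j ω = 1)
  have hS : Measurable S := measurable_pi_lambda _ fun j =>
    measurable_to_bool (by
      have : (fun ω => S ω j) ⁻¹' {true} = ε j ⁻¹' {1} := by ext; simp [S]
      rw [this]
      exact h.measurable j (measurableSet_singleton 1))
  set F : (ι → Bool) → ℝ := fun s => G fun j => boolSign (s j)
  have hF : Integrable F (μ.map S) := by
    have := Measure.isProbabilityMeasure_map (μ := μ) hS.aemeasurable
    exact Integrable.of_finite
  have hae : (fun ω => G fun j => ε j ω) =ᵐ[μ] fun ω => F (S ω) := by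
    filter_upwards [ae_all_iff.2 h.ae_eq_one_or] with ω hω
    refine congrArg G (funext fun j => ?_)
    rcases hω j with h1 | h1
    · simp [S, boolSign, h1]
    · have h2 : (-1 : ℝ) ≠ 1 := by norm_num
      simp [S, boolSign, h1, h2]
  refine ⟨(hF.comp_measurable hS).congr hae.symm, ?_⟩
  rw [integral_congr_ae hae, ← integral_map hS.aemeasurable hF.aestronglyMeasurable,
    integral_fintype hF]
  refine Finset.sum_congr rfl fun s _ => ?_
  rw [map_measureReal_apply hS (measurableSet_singleton s), smul_eq_mul]
  congr 1
  exact h.measure_preimage s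

end Probability

/-! ### Square functions of rank-one families. -/

section RankOne

variable {m : ℕ} {ι : Type*} [Fintype ι]

theorem adjoint_tensorOp (x y : EuclideanSpace ℝ (Fin m)) :
    ContinuousLinearMap.adjoint (tensorOp x y) = tensorOp y x := by
  refine ((ContinuousLinearMap.eq_adjoint_iff _ _).2 fun a b => ?_).symm
  rw [tensorOp_apply, tensorOp_apply, real_inner_smul_left, real_inner_smul_right,
    real_inner_comm b x, real_inner_comm a y, mul_comm]

theorem sum_inner_sq_le (x : ι → EuclideanSpace ℝ (Fin m)) (a : EuclideanSpace ℝ (Fin m)) :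
    ∑ j, inner ℝ (x j) a ^ 2 ≤ ‖∑ j, tensorOp (x j) (x j)‖ * ‖a‖ ^ 2 := by
  have h : ∑ j, inner ℝ (x j) a ^ 2 = inner ℝ a ((∑ j, tensorOp (x j) (x j)) a) := by
    rw [sum_apply, inner_sum]
    refine Finset.sum_congr rfl fun j _ => ?_
    rw [tensorOp_apply, real_inner_smul_right, real_inner_comm a, sq]
  rw [h]
  refine (real_inner_le_norm _ _).trans ?_
  have h1 := (∑ j, tensorOp (x j) (x j)).le_opNorm a
  nlinarith [norm_nonneg a]

theorem sum_norm_tensorOp_apply_sq_le (x y : ι → EuclideanSpace ℝ (Fin m))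
    (a : EuclideanSpace ℝ (Fin m)) :
    ∑ j, ‖tensorOp (x j) (y j) a‖ ^ 2 ≤
      ((⨆ j, ‖y j‖) * √‖∑ j, tensorOp (x j) (x j)‖) ^ 2 * ‖a‖ ^ 2 := by
  rw [mul_pow, Real.sq_sqrt (norm_nonneg _), mul_assoc]
  refine le_trans ?_ (mul_le_mul_of_nonneg_left (sum_inner_sq_le x a) (sq_nonneg _))
  rw [Finset.mul_sum]
  refine Finset.sum_le_sum fun j _ => ?_
  rw [tensorOp_apply, norm_smul, mul_pow, Real.norm_eq_abs, sq_abs, mul_comm]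
  gcongr
  exact le_ciSup (f := fun j => ‖y j‖) (Set.finite_range _).bddAbove j

end RankOne

theorem mainTheorem2 :
    ∃ C : ℝ, 0 < C ∧
      ∀ (m : ℕ), 2 ≤ m →
      ∀ (ι : Type*) [Fintype ι] (x y : ι → EuclideanSpace ℝ (Fin m))
        (Ω : Type*) [MeasurableSpace Ω] (μ : Measure Ω) [IsProbabilityMeasure μ]
        (ε : ι → Ω → ℝ), IsRademacherFamily μ ε →
        Integrable (fun ω => ‖∑ j, ε j ω • tensorOp (x j) (y j)‖) μ ∧
        ∫ ω, ‖∑ j, ε j ω • tensorOp (x j) (y j)‖ ∂μ ≤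
          C * √(Real.log m) *
            ((⨆ j, ‖x j‖) * √‖∑ j, tensorOp (y j) (y j)‖ +
              (⨆ j, ‖y j‖) * √‖∑ j, tensorOp (x j) (x j)‖) := by
  classical
  refine ⟨Real.exp 1 * √6, by positivity, fun m hm ι _ x y Ω _ μ _ ε hε => ?_⟩
  obtain ⟨h1, h2⟩ := hε.integral_comp fun c => ‖∑ j, c j • tensorOp (x j) (y j)‖
  refine ⟨h1, h2.trans_le ?_⟩
  set a := (⨆ j, ‖x j‖) * √‖∑ j, tensorOp (y j) (y j)‖
  set b := (⨆ j, ‖y j‖) * √‖∑ j, tensorOp (x j) (x j)‖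
  -- This covers the empty family too, where the real supremum is `0`.
  have ha : 0 ≤ a := mul_nonneg (Real.iSup_nonneg fun j => norm_nonneg _) (Real.sqrt_nonneg _)
  have hb : 0 ≤ b := mul_nonneg (Real.iSup_nonneg fun j => norm_nonneg _) (Real.sqrt_nonneg _)
  have hm' : (2 : ℝ) ≤ m := by exact_mod_cast hm
  have hlog2 : Real.log 2 ≤ Real.log m := Real.log_le_log (by norm_num) hm'
  have hlog : 0.69 ≤ Real.log m := by linarith [Real.log_two_gt_d9]
  set p := ⌈Real.log m⌉₊
  have hp : p ≠ 0 := (Nat.ceil_pos.2 (by linarith)).ne'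
  have hlogp : Real.log m ≤ p := Nat.le_ceil _
  -- Rounding up costs less than `1`, and `1 ≤ 2 log m` since `m ≥ 2`; hence the `√6` in the
  -- constant.
  have hplog : (p : ℝ) ≤ 3 * Real.log m := by
    have := Nat.ceil_lt_add_one (a := Real.log m) (by linarith)
    linarith
  have hdim : 2 * (Module.finrank ℝ (EuclideanSpace ℝ (Fin m)) : ℝ) ≤ Real.exp 1 ^ (2 * p) := by
    rw [finrank_euclideanSpace_fin]
    have h3 : (m : ℝ) ≤ Real.exp 1 ^ p := by
      rw [← Real.exp_nat_mul, mul_one, ← Real.log_le_iff_le_exp (by linarith)]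
      exact hlogp
    calc (2 : ℝ) * m ≤ Real.exp 1 ^ p * Real.exp 1 ^ p :=
          mul_le_mul (hm'.trans h3) h3 (by linarith) (by positivity)
      _ = Real.exp 1 ^ (2 * p) := by rw [two_mul, pow_add]
  -- The single variance `(a + b)²` dominates both `b²` for the operators and `a²` for their
  -- adjoints.
  have hV (z : EuclideanSpace ℝ (Fin m)) :
      ∑ j, ‖tensorOp (x j) (y j) z‖ ^ 2 ≤ (a + b) ^ 2 * ‖z‖ ^ 2 := by
    refine (sum_norm_tensorOp_apply_sq_le x y z).trans ?_
    gcongr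
    linarith
  have hV' (z : EuclideanSpace ℝ (Fin m)) :
      ∑ j, ‖ContinuousLinearMap.adjoint (tensorOp (x j) (y j)) z‖ ^ 2 ≤
        (a + b) ^ 2 * ‖z‖ ^ 2 := by
    simp only [adjoint_tensorOp]
    refine (sum_norm_tensorOp_apply_sq_le y x z).trans ?_
    gcongr
    linarith
  refine (average_norm_signedSum_le (sq_nonneg _) hV hV' hp hdim).trans ?_
  rw [Real.sqrt_mul (by positivity), Real.sqrt_sq (by positivity), ← mul_assoc, mul_assoc _ (√6),
    ← Real.sqrt_mul (by norm_num)]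
  have hsqrt : √(2 * p) ≤ √(6 * Real.log m) := Real.sqrt_le_sqrt (by linarith)
  gcongr
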